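/- Work over $\mathbb C$. Let $\Sigma\subset\mathbb P^5$ be a quartic scroll that is the image of $\mathbb P^1\times\mathbb P^1$ under the morphism $\varphi$ given by the complete linear series $|\mathcal O_{\mathbb P^1\times\mathbb P^1}(1,2)|$, with respect to an arbitrary basis $f_0,\dots,f_5$ of the space of bihomogeneous forms of bidegree $(1,2)$ in $(s_0,s_1;t_0,t_1)$. A secant to $\Sigma$ is a line in $\mathbb P^5$ joining two distinct points of $\Sigma$. Then: (i) a generic point of $\mathbb P^5$ (that is, every point of some nonempty Zariski open subset) lies on exactly one secant to $\Sigma$; (ii) let $\nu:\mathbb P^1\hookrightarrow\mathbb P^2$, $[t_0:t_1]\mapsto[t_0^2:t_0t_1:t_1^2]$, be the Veronese embedding. There is exactly one basis $F_0,\dots,F_5$ of the space of bihomogeneous forms of bidegree $(1,1)$ in $(s_0,s_1;w_0,w_1,w_2)$ with $F_i(s;\,t_0^2,t_0t_1,t_1^2)=f_i(s;t)$ for all $i$; it defines a Segre embedding $\psi:\mathbb P^1\times\mathbb P^2\hookrightarrow\mathbb P^5$ with $\psi\circ(\mathrm{id}\times\nu)=\varphi$. The set of points of $\mathbb P^5$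 that lie on more than one secant to $\Sigma$ is the Segre threefold $\psi(\mathbb P^1\times\mathbb P^2)$. -/

import Mathlib

open scoped LinearAlgebra.Projectivization

noncomputable section

namespace QuarticScroll

/-- Complex projective space `ℙⁿ`. -/
abbrev PSpace (n : ℕ) : Type := ℙ ℂ (Fin (n + 1) → ℂ)

/-- The bigrading on the coordinate ring of `ℙᵃ × ℙᵇ`. -/
def biWeight (a b : ℕ) : Fin (a + 1) ⊕ Fin (b + 1) → ℕ × ℕ :=
  Sum.elim (fun _ => (1, 0)) (fun _ => (0, 1))

/-- The space `H⁰(ℙᵃ × ℙᵇ, 𝒪(d, e))` of bihomogeneous forms of bidegree `(d, e)`. -/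
abbrev BiForm (a b d e : ℕ) : Submodule ℂ (MvPolynomial (Fin (a + 1) ⊕ Fin (b + 1)) ℂ) :=
  MvPolynomial.weightedHomogeneousSubmodule ℂ (biWeight a b) (d, e)

/-- The vector of values at `(s, t)` of a family of forms. -/
def evalVec {a b d e n : ℕ} (f : Fin (n + 1) → BiForm a b d e)
    (s : Fin (a + 1) → ℂ) (t : Fin (b + 1) → ℂ) : Fin (n + 1) → ℂ :=
  fun i => MvPolynomial.eval (Sum.elim s t) (f i : MvPolynomial (Fin (a + 1) ⊕ Fin (b + 1)) ℂ)

/-- The complete linear series `|𝒪(d, e)|` has no base points. -/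
theorem evalVec_ne_zero {a b d e n : ℕ} (f : Module.Basis (Fin (n + 1)) ℂ (BiForm a b d e))
    {s : Fin (a + 1) → ℂ} {t : Fin (b + 1) → ℂ} (hs : s ≠ 0) (ht : t ≠ 0) :
    evalVec f s t ≠ 0 := by
  intro h
  obtain ⟨i, hi⟩ := Function.ne_iff.mp hs
  obtain ⟨j, hj⟩ := Function.ne_iff.mp ht
  let L : BiForm a b d e →ₗ[ℂ] ℂ :=
    (MvPolynomial.aeval (R := ℂ) (Sum.elim s t)).toLinearMap ∘ₗ (BiForm a b d e).subtype
  have hL : L = 0 := f.ext fun k => by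
    simpa [L, evalVec, MvPolynomial.aeval_eq_eval] using congrFun h k
  have hm : (MvPolynomial.X (Sum.inl i) ^ d * MvPolynomial.X (Sum.inr j) ^ e :
      MvPolynomial (Fin (a + 1) ⊕ Fin (b + 1)) ℂ) ∈ BiForm a b d e := by
    rw [MvPolynomial.mem_weightedHomogeneousSubmodule]
    have h1 := (MvPolynomial.isWeightedHomogeneous_X ℂ (biWeight a b) (Sum.inl i)).pow d
    have h2 := (MvPolynomial.isWeightedHomogeneous_X ℂ (biWeight a b) (Sum.inr j)).pow e
    have h3 := h1.mul h2
    simpa [biWeight] using h3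
  have h0 := LinearMap.congr_fun hL ⟨_, hm⟩
  simp only [L, LinearMap.comp_apply, Submodule.subtype_apply, AlgHom.toLinearMap_apply,
    map_mul, map_pow, MvPolynomial.aeval_X, Sum.elim_inl, Sum.elim_inr,
    LinearMap.zero_apply] at h0
  exact mul_ne_zero (pow_ne_zero d hi) (pow_ne_zero e hj) h0

/-- The morphism `ℙᵃ × ℙᵇ → ℙⁿ` given by the complete linear series `|𝒪(d, e)|` with respect to
the basis `f` of the space of sections. By `linearSeriesMap_mk` the choice of representatives of the
points is immaterial. -/
def linearSeriesMap {a b d e n : ℕ} (f : Module.Basis (Fin (n + 1)) ℂ (BiForm a b d e))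
    (x : PSpace a × PSpace b) : PSpace n :=
  Projectivization.mk ℂ (evalVec f x.1.rep x.2.rep)
    (evalVec_ne_zero f x.1.rep_nonzero x.2.rep_nonzero)

theorem evalVec_smul {a b d e n : ℕ} (f : Fin (n + 1) → BiForm a b d e) (α β : ℂ)
    (s : Fin (a + 1) → ℂ) (t : Fin (b + 1) → ℂ) :
    evalVec f (α • s) (β • t) = (α ^ d * β ^ e) • evalVec f s t := by
  funext k
  simp only [evalVec, Pi.smul_apply, smul_eq_mul, MvPolynomial.eval_eq', Finset.mul_sum]
  refine Finset.sum_congr rfl fun m hm => ?_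
  have hw := (f k).2 (MvPolynomial.mem_support_iff.mp hm)
  rw [Finsupp.weight_apply, Finsupp.sum_fintype _ _ (by simp)] at hw
  have hd : ∑ i, m (Sum.inl i) = d := by
    simpa [biWeight, Prod.fst_sum, -nsmul_eq_mul] using congrArg Prod.fst hw
  have he : ∑ j, m (Sum.inr j) = e := by
    simpa [biWeight, Prod.snd_sum, -nsmul_eq_mul] using congrArg Prod.snd hw
  simp only [Fintype.prod_sum_type, Sum.elim_inl, Sum.elim_inr, Pi.smul_apply, smul_eq_mul,
    mul_pow, Finset.prod_mul_distrib, Finset.prod_pow_eq_pow_sum, hd, he]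
  ring

theorem linearSeriesMap_mk {a b d e n : ℕ} (f : Module.Basis (Fin (n + 1)) ℂ (BiForm a b d e))
    {s : Fin (a + 1) → ℂ} {t : Fin (b + 1) → ℂ} (hs : s ≠ 0) (ht : t ≠ 0) :
    linearSeriesMap f (Projectivization.mk ℂ s hs, Projectivization.mk ℂ t ht) =
      Projectivization.mk ℂ (evalVec f s t) (evalVec_ne_zero f hs ht) := by
  obtain ⟨α, hα⟩ := Projectivization.exists_smul_eq_mk_rep ℂ s hs
  obtain ⟨β, hβ⟩ := Projectivization.exists_smul_eq_mk_rep ℂ t ht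
  rw [linearSeriesMap, Projectivization.mk_eq_mk_iff']
  refine ⟨(α : ℂ) ^ d * (β : ℂ) ^ e, ?_⟩
  rw [← evalVec_smul]
  exact congrArg₂ (evalVec f) hα hβ

/-- The image of `ℙᵃ × ℙᵇ` in `ℙⁿ` under the complete linear series `|𝒪(d, e)|`. For
`(a, b, d, e) = (1, 1, 1, 2)` and `n = 5` this is a quartic scroll, for `(a, b, d, e) = (1, 2, 1, 1)`
and `n = 5` a Segre threefold. -/
def linearSeriesImage {a b d e n : ℕ} (f : Module.Basis (Fin (n + 1)) ℂ (BiForm a b d e)) :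
    Set (PSpace n) :=
  Set.range (linearSeriesMap f)

/-- Pullback of forms along `id × ν : ℙ¹ × ℙ¹ → ℙ¹ × ℙ²`, where `ν` is the Veronese embedding
`[t₀ : t₁] ↦ [t₀² : t₀ t₁ : t₁²]`. -/
def veronesePullback :
    MvPolynomial (Fin 2 ⊕ Fin 3) ℂ →ₐ[ℂ] MvPolynomial (Fin 2 ⊕ Fin 2) ℂ :=
  MvPolynomial.aeval (Sum.elim (fun i => MvPolynomial.X (Sum.inl i))
    ![MvPolynomial.X (Sum.inr 0) ^ 2,
      MvPolynomial.X (Sum.inr 0) * MvPolynomial.X (Sum.inr 1),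
      MvPolynomial.X (Sum.inr 1) ^ 2])

/-- The Segre embedding `|𝒪(1, 1)|` of `ℙ¹ × ℙ²` given by `F` restricts along `id × ν` to the
embedding `|𝒪(1, 2)|` of `ℙ¹ × ℙ¹` given by `f`. -/
def IsVeroneseExtension (f : Module.Basis (Fin 6) ℂ (BiForm 1 1 1 2))
    (F : Module.Basis (Fin 6) ℂ (BiForm 1 2 1 1)) : Prop :=
  ∀ i, veronesePullback (F i : MvPolynomial (Fin 2 ⊕ Fin 3) ℂ) =
    (f i : MvPolynomial (Fin 2 ⊕ Fin 2) ℂ)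

/-- A secant line to `S`: the line joining two distinct points of `S`. -/
def IsSecant {n : ℕ} (S : Set (PSpace n))
    (l : Projectivization.Subspace ℂ (Fin (n + 1) → ℂ)) : Prop :=
  ∃ x ∈ S, ∃ y ∈ S, x ≠ y ∧ l = Projectivization.Subspace.span {x, y}

/-- Zariski closed subsets of `ℙⁿ`: common zero loci of sets of homogeneous polynomials. -/
def IsZariskiClosed {n : ℕ} (Z : Set (PSpace n)) : Prop :=
  ∃ G : Set (MvPolynomial (Fin (n + 1)) ℂ), (∀ g ∈ G, ∃ k, g.IsHomogeneous k) ∧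
    Z = {p | ∀ g ∈ G, MvPolynomial.eval p.rep g = 0}

/-- A property holds at a generic point of `ℙⁿ` if it holds on a nonempty Zariski open subset. -/
def HoldsGenerically {n : ℕ} (P : PSpace n → Prop) : Prop :=
  ∃ U : Set (PSpace n), IsZariskiClosed Uᶜ ∧ U.Nonempty ∧ ∀ p ∈ U, P p

end QuarticScroll

end

/-! In the coordinates of `segreEquiv F`, `ℙ⁵` is the projective space of `2 × 3` matrices, the
Segre threefold is the locus of rank one matrices `s ⊗ w`, and the scroll consists of the matrices
`s ⊗ ν(t)`.

A point off the threefold is a matrix `M` of rank two, so its row space is a line in `ℙ²`. If `M = s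
⊗ ν(t) + s' ⊗ ν(t')`, that line is the chord of the conic through `ν(t)` and `ν(t')`. Hence `M`
determines the two points of the conic, then `s` and `s'`, so at most one secant passes through `M`
(`decomposition_unique`, `secant_unique`). Such a decomposition exists as soon as the line is not
tangent to the conic, that is, off the quartic hypersurface `secantDiscriminant = 0`, which contains
the threefold (`exists_decomposition`).

For a rank one matrix `s ⊗ w`, each chord of the conic through `w` gives a secant inside the plane
`{s} × ℙ²`, and there are several such chords (`exists_two_chords`, `exists_two_secants`).

The extension `F` exists and is unique because restriction to the conic is an isomorphism from forms
of bidegree `(1, 1)` to forms of bidegree `(1, 2)`: no line contains the conic, and both spaces have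
dimension six. -/

noncomputable section

namespace QuarticScroll

open Matrix

/-! ### The conic in the plane and its chords -/

/-- The affine Veronese map `(t₀, t₁) ↦ (t₀², t₀ t₁, t₁²)`. -/
def veronese (t : Fin 2 → ℂ) : Fin 3 → ℂ := ![t 0 ^ 2, t 0 * t 1, t 1 ^ 2]

/-- The determinant of two vectors of `ℂ²`. -/
def bracket (t u : Fin 2 → ℂ) : ℂ := t 0 * u 1 - t 1 * u 0

/-- The linear form on `ℂ³` whose zero locus is the chord of the conic through `veronese t` and
`veronese u` (the tangent line if `t = u`). -/
def chordForm (t u : Fin 2 → ℂ) (w : Fin 3 → ℂ) : ℂ :=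
  t 1 * u 1 * w 0 - (t 0 * u 1 + t 1 * u 0) * w 1 + t 0 * u 0 * w 2

/-- This turns incidence with the conic into vanishing of brackets. Taking `t = u` gives the tangent
form, with a double zero at `t`. -/
theorem chordForm_veronese (t u v : Fin 2 → ℂ) :
    chordForm t u (veronese v) = bracket t v * bracket u v := by
  simp only [chordForm, veronese, bracket, cons_val]
  ring

theorem chordForm_add (t u : Fin 2 → ℂ) (v w : Fin 3 → ℂ) :
    chordForm t u (v + w) = chordForm t u v + chordForm t u w := by
  simp only [chordForm, Pi.add_apply]
  ring

theorem chordForm_smul (t u : Fin 2 → ℂ) (c : ℂ) (w : Fin 3 → ℂ) :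
    chordForm t u (c • w) = c * chordForm t u w := by
  simp only [chordForm, Pi.smul_apply, smul_eq_mul]
  ring

theorem veronese_smul (c : ℂ) (t : Fin 2 → ℂ) : veronese (c • t) = c ^ 2 • veronese t := by
  funext k
  fin_cases k <;> simp [veronese] <;> ring

theorem bracket_self (t : Fin 2 → ℂ) : bracket t t = 0 := by
  simp only [bracket]
  ring

theorem bracket_swap (t u : Fin 2 → ℂ) : bracket u t = -bracket t u := by
  simp only [bracket]
  ring

theorem ne_zero_of_bracket_ne_zero {t u : Fin 2 → ℂ} (h : bracket t u ≠ 0) : t ≠ 0 := by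
  rintro rfl
  simp [bracket] at h

theorem ne_zero_of_bracket_ne_zero_right {t u : Fin 2 → ℂ} (h : bracket t u ≠ 0) : u ≠ 0 := by
  rintro rfl
  simp [bracket] at h

theorem exists_eq_smul_of_bracket_eq_zero {t u : Fin 2 → ℂ} (ht : t ≠ 0) (h : bracket t u = 0) :
    ∃ c : ℂ, u = c • t := by
  simp only [bracket] at h
  by_cases h0 : t 0 = 0
  · have h1 : t 1 ≠ 0 := fun h1 => ht (by funext k; fin_cases k <;> simp [h0, h1])
    refine ⟨u 1 / t 1, ?_⟩
    have hu : u 0 = 0 := by simpa [h0, h1] using h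
    funext k
    fin_cases k <;> simp [h0, h1, hu]
  · refine ⟨u 0 / t 0, ?_⟩
    funext k
    fin_cases k
    · simp [h0]
    · simp only [Fin.mk_one, Pi.smul_apply, smul_eq_mul]
      field_simp
      linear_combination h

theorem bracket_smul_smul (a b : ℂ) (t u : Fin 2 → ℂ) :
    bracket (a • t) (b • u) = a * b * bracket t u := by
  simp only [bracket, Pi.smul_apply, smul_eq_mul]
  ring

/-- A vector on the chord through two distinct points of the conic is a combination of them. -/
theorem exists_eq_add_of_chordForm_eq_zero {t u : Fin 2 → ℂ} (h : bracket t u ≠ 0)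
    {w : Fin 3 → ℂ} (hw : chordForm t u w = 0) :
    ∃ a b : ℂ, w = a • veronese t + b • veronese u := by
  -- The tangent form at `u` kills `veronese u` and equals `bracket t u ^ 2` on `veronese t`, which
  -- dictates the first coefficient; the second is symmetric.
  refine ⟨chordForm u u w / bracket t u ^ 2, chordForm t t w / bracket t u ^ 2, ?_⟩
  have h2 : bracket t u ^ 2 ≠ 0 := pow_ne_zero 2 h
  have key : bracket t u ^ 2 • w =
      chordForm u u w • veronese t + chordForm t t w • veronese u := by
    simp only [chordForm] at hw
    funext k
    fin_cases k <;> simp [veronese, chordForm, bracket]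
    · linear_combination (-2 * t 0 * u 0) * hw
    · linear_combination (-(t 0 * u 1 + t 1 * u 0)) * hw
    · linear_combination (-2 * t 1 * u 1) * hw
  rw [div_eq_inv_mul, div_eq_inv_mul, mul_smul, mul_smul, ← smul_add, ← key, smul_smul,
    inv_mul_cancel₀ h2, one_smul]

/-- A binary quadratic form with nonzero discriminant is a product of two independent linear
forms. -/
theorem exists_chordForm_eq {n : Fin 3 → ℂ} (h : n 1 ^ 2 - 4 * n 0 * n 2 ≠ 0) :
    ∃ t u : Fin 2 → ℂ, bracket t u ≠ 0 ∧
      ∀ w, chordForm t u w = n 0 * w 0 + n 1 * w 1 + n 2 * w 2 := by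
  by_cases h0 : n 0 = 0
  -- On the conic the form becomes `v₁ (n₁ v₀ + n₂ v₁)`, with these two roots.
  · refine ⟨![1, 0], ![n 2, -n 1], ?_, fun w => ?_⟩
    · intro hb
      apply h
      have : n 1 = 0 := by simpa [bracket] using hb
      simp [h0, this]
    · simp [chordForm, h0]
  · obtain ⟨r, hr⟩ := IsAlgClosed.exists_pow_nat_eq (n 1 ^ 2 - 4 * n 0 * n 2) (n := 2) two_pos
    -- The roots come from the quadratic formula; the second is divided by `n 0` so that the leading
    -- coefficient `t 1 * u 1` is `n 0`. The bracket of the two is then `r`.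
    refine ⟨![(-n 1 + r) / 2, n 0], ![(-n 1 - r) / (2 * n 0), 1], ?_, fun w => ?_⟩
    · have hb : bracket ![(-n 1 + r) / 2, n 0] ![(-n 1 - r) / (2 * n 0), 1] = r := by
        simp only [bracket, cons_val]
        field_simp
        ring
      rw [hb]
      rintro rfl
      exact h (by rw [← hr]; simp)
    · simp only [chordForm, cons_val]
      field_simp
      linear_combination (-w 2) * hr

/-! ### Decompositions of a `2 × 3` matrix along the scroll -/

/-- A dependence between `s` and `s'`, or between `t` and `t'`, would merge the two summands into a
single `vecMulVec`. -/
theorem bracket_ne_zero_of_eq_add {M : Matrix (Fin 2) (Fin 3) ℂ} (hM : ∀ s w, M ≠ vecMulVec s w)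
    {s s' t t' : Fin 2 → ℂ}
    (h : M = vecMulVec s (veronese t) + vecMulVec s' (veronese t')) :
    bracket s s' ≠ 0 ∧ bracket t t' ≠ 0 := by
  constructor
  · intro hb
    by_cases hs : s = 0
    · exact hM s' (veronese t') (by rw [h, hs]; simp)
    · obtain ⟨c, rfl⟩ := exists_eq_smul_of_bracket_eq_zero hs hb
      exact hM s (veronese t + c • veronese t') (by
        rw [h, vecMulVec_add, vecMulVec_smul, smul_vecMulVec])
  · intro hb
    by_cases ht : t = 0
    · exact hM s' (veronese t') (by rw [h, ht]; ext i k; fin_cases k <;> simp [veronese, vecMulVec])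
    · obtain ⟨c, rfl⟩ := exists_eq_smul_of_bracket_eq_zero ht hb
      exact hM (s + c ^ 2 • s') (veronese t) (by
        rw [h, veronese_smul, vecMulVec_smul, add_vecMulVec, smul_vecMulVec])

theorem chordForm_decomposition (v u s s' t t' : Fin 2 → ℂ) (j : Fin 2) :
    chordForm v u ((vecMulVec s (veronese t) + vecMulVec s' (veronese t')) j) =
      s j * (bracket v t * bracket u t) + s' j * (bracket v t' * bracket u t') := by
  rw [← chordForm_veronese, ← chordForm_veronese, ← chordForm_smul, ← chordForm_smul,
    ← chordForm_add]
  rfl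

theorem eq_zero_of_bracket_ne_zero {s s' : Fin 2 → ℂ} (h : bracket s s' ≠ 0) {a b : ℂ}
    (hab : ∀ j, s j * a + s' j * b = 0) : a = 0 ∧ b = 0 := by
  have h0 := hab 0
  have h1 := hab 1
  constructor
  · refine (mul_eq_zero.mp ?_).resolve_left h
    simp only [bracket]
    linear_combination s' 1 * h0 - s' 0 * h1
  · refine (mul_eq_zero.mp ?_).resolve_left h
    simp only [bracket]
    linear_combination s 0 * h1 - s 1 * h0

/-- Applied to the rows, the tangent form at `t'` kills the second summand but not the first, which
isolates the first coefficient; the tangent form at `t` isolates the second. -/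
theorem decomposition_coeff_unique {t t' : Fin 2 → ℂ} (h : bracket t t' ≠ 0)
    {s₁ s₂ s₃ s₄ : Fin 2 → ℂ}
    (he : vecMulVec s₁ (veronese t) + vecMulVec s₂ (veronese t') =
      vecMulVec s₃ (veronese t) + vecMulVec s₄ (veronese t')) : s₁ = s₃ ∧ s₂ = s₄ := by
  have h' : bracket t' t ≠ 0 := by rwa [bracket_swap, neg_ne_zero]
  constructor
  · funext j
    have := congrArg (fun N : Matrix (Fin 2) (Fin 3) ℂ => chordForm t' t' (N j)) he
    simpa [chordForm_decomposition, bracket_self, h'] using this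
  · funext j
    have := congrArg (fun N : Matrix (Fin 2) (Fin 3) ℂ => chordForm t t (N j)) he
    simpa [chordForm_decomposition, bracket_self, h] using this

theorem decomposition_unique_of_bracket_eq_zero {M : Matrix (Fin 2) (Fin 3) ℂ}
    (hM : ∀ s w, M ≠ vecMulVec s w) {s₁ s₂ s₃ s₄ t₁ t₂ t₃ t₄ : Fin 2 → ℂ}
    (h : M = vecMulVec s₁ (veronese t₁) + vecMulVec s₂ (veronese t₂))
    (h' : M = vecMulVec s₃ (veronese t₃) + vecMulVec s₄ (veronese t₄))
    (h13 : bracket t₁ t₃ = 0) (h24 : bracket t₂ t₄ = 0) :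
    vecMulVec s₁ (veronese t₁) = vecMulVec s₃ (veronese t₃) ∧
      vecMulVec s₂ (veronese t₂) = vecMulVec s₄ (veronese t₄) := by
  have ht := (bracket_ne_zero_of_eq_add hM h).2
  obtain ⟨a, rfl⟩ := exists_eq_smul_of_bracket_eq_zero (ne_zero_of_bracket_ne_zero ht) h13
  obtain ⟨b, rfl⟩ := exists_eq_smul_of_bracket_eq_zero (ne_zero_of_bracket_ne_zero_right ht) h24
  have he := h.symm.trans h'
  simp only [veronese_smul, vecMulVec_smul, ← smul_vecMulVec] at he ⊢
  obtain ⟨rfl, rfl⟩ := decomposition_coeff_unique ht he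
  exact ⟨rfl, rfl⟩

/-- A matrix of rank two is in at most one way a sum of two points of the cone over the scroll. -/
theorem decomposition_unique {M : Matrix (Fin 2) (Fin 3) ℂ}
    (hM : ∀ s w, M ≠ vecMulVec s w) {s₁ s₂ s₃ s₄ t₁ t₂ t₃ t₄ : Fin 2 → ℂ}
    (h : M = vecMulVec s₁ (veronese t₁) + vecMulVec s₂ (veronese t₂))
    (h' : M = vecMulVec s₃ (veronese t₃) + vecMulVec s₄ (veronese t₄)) :
    (vecMulVec s₁ (veronese t₁) = vecMulVec s₃ (veronese t₃) ∧
      vecMulVec s₂ (veronese t₂) = vecMulVec s₄ (veronese t₄)) ∨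
    (vecMulVec s₁ (veronese t₁) = vecMulVec s₄ (veronese t₄) ∧
      vecMulVec s₂ (veronese t₂) = vecMulVec s₃ (veronese t₃)) := by
  obtain ⟨hs, ht⟩ := bracket_ne_zero_of_eq_add hM h'
  -- The chord form of `t₁`, `t₂` kills every row of `M`. Since `s₃`, `s₄` are independent, it also
  -- vanishes at `veronese t₃` and `veronese t₄`.
  have hz := eq_zero_of_bracket_ne_zero hs
    (a := bracket t₁ t₃ * bracket t₂ t₃) (b := bracket t₁ t₄ * bracket t₂ t₄) fun j => by
      rw [← chordForm_decomposition, ← h', h, chordForm_decomposition]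
      simp [bracket_self]
  -- `t₃` and `t₄` are independent, so they cannot both be proportional to the same `t`; this makes
  -- the matching of pairs a bijection.
  have hne : ∀ t, t ≠ 0 → bracket t t₃ = 0 → bracket t t₄ ≠ 0 := by
    intro t h0 h3 h4
    obtain ⟨a, rfl⟩ := exists_eq_smul_of_bracket_eq_zero h0 h3
    obtain ⟨b, rfl⟩ := exists_eq_smul_of_bracket_eq_zero h0 h4
    exact ht (by rw [bracket_smul_smul, bracket_self, mul_zero])
  have h12 := (bracket_ne_zero_of_eq_add hM h).2
  rcases mul_eq_zero.mp hz.1 with h3 | h3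
  · have h4 := (mul_eq_zero.mp hz.2).resolve_left (hne _ (ne_zero_of_bracket_ne_zero h12) h3)
    exact Or.inl (decomposition_unique_of_bracket_eq_zero hM h h' h3 h4)
  · have h4 := (mul_eq_zero.mp hz.2).resolve_right
      (hne _ (ne_zero_of_bracket_ne_zero_right h12) h3)
    exact Or.inr (decomposition_unique_of_bracket_eq_zero hM h (h'.trans (add_comm _ _)) h4 h3)

/-- The discriminant of the binary quadratic form cut out on the conic by the row space of a
`2 × 3` matrix. -/
def secantDiscriminant {R : Type*} [CommRing R] (M : Matrix (Fin 2) (Fin 3) R) : R :=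
  (M 0 2 * M 1 0 - M 0 0 * M 1 2) ^ 2 -
    4 * (M 0 1 * M 1 2 - M 0 2 * M 1 1) * (M 0 0 * M 1 1 - M 0 1 * M 1 0)

theorem secantDiscriminant_vecMulVec (s : Fin 2 → ℂ) (w : Fin 3 → ℂ) :
    secantDiscriminant (vecMulVec s w) = 0 := by
  simp only [secantDiscriminant, vecMulVec_apply]
  ring

/-- The cross product of the rows is a linear form vanishing on both of them. Nonzero discriminant
makes it the chord form of two distinct points of the conic, so each row is a combination of those
points. -/
theorem exists_decomposition {M : Matrix (Fin 2) (Fin 3) ℂ} (h : secantDiscriminant M ≠ 0) :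
    ∃ s s' t t' : Fin 2 → ℂ, M = vecMulVec s (veronese t) + vecMulVec s' (veronese t') := by
  obtain ⟨t, u, htu, hc⟩ := exists_chordForm_eq
    (n := ![M 0 1 * M 1 2 - M 0 2 * M 1 1, M 0 2 * M 1 0 - M 0 0 * M 1 2,
      M 0 0 * M 1 1 - M 0 1 * M 1 0]) h
  have hrow : ∀ j, ∃ a b : ℂ, M j = a • veronese t + b • veronese u := fun j => by
    refine exists_eq_add_of_chordForm_eq_zero htu ?_
    rw [hc]
    fin_cases j <;> simp <;> ring
  choose a b hab using hrow
  refine ⟨a, b, t, u, ?_⟩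
  funext j
  exact hab j

/-- Every point of the plane lies on two distinct chords of the conic. -/
theorem exists_two_chords {w : Fin 3 → ℂ} (hw : w ≠ 0) :
    ∃ t₁ t₂ t₃ t₄ : Fin 2 → ℂ, bracket t₁ t₂ ≠ 0 ∧ bracket t₃ t₄ ≠ 0 ∧
      chordForm t₁ t₂ w = 0 ∧ chordForm t₃ t₄ w = 0 ∧ chordForm t₁ t₂ (veronese t₃) ≠ 0 := by
  -- `q` is `chordForm (τ z) (τ z) w` as a polynomial in `z`.
  let q : Polynomial ℂ :=
    Polynomial.C (w 0) * Polynomial.X ^ 2 + Polynomial.C (-2 * w 1) * Polynomial.X +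
      Polynomial.C (w 2)
  have hq : q ≠ 0 := by
    intro h
    apply hw
    have h0 := congrArg (fun p => Polynomial.coeff p 0) h
    have h1 := congrArg (fun p => Polynomial.coeff p 1) h
    have h2 := congrArg (fun p => Polynomial.coeff p 2) h
    simp [q, -map_mul, -map_neg, Polynomial.coeff_X, Polynomial.coeff_C] at h0 h1 h2
    funext k
    fin_cases k <;> simp [h0, h1, h2]
  let τ : ℂ → Fin 2 → ℂ := fun z => ![1, z]
  -- `chordForm (τ z) u w = 0` is linear in `u`, and `σ z` solves it. It is independent of `τ z`
  -- when `q.eval z ≠ 0`, because their bracket is `-q.eval z`.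
  let σ : ℂ → Fin 2 → ℂ := fun z => ![z * w 0 - w 1, z * w 1 - w 2]
  have hσ : ∀ z, chordForm (τ z) (σ z) w = 0 := fun z => by
    simp only [chordForm, τ, σ, cons_val]
    ring
  have hb : ∀ z, q.eval z ≠ 0 → bracket (τ z) (σ z) ≠ 0 := fun z hz h => by
    apply hz
    simp only [bracket, τ, σ, cons_val] at h
    simp only [q, Polynomial.eval_add, Polynomial.eval_mul, Polynomial.eval_C, Polynomial.eval_pow,
      Polynomial.eval_X]
    linear_combination -h
  have hinf : ∀ p : Polynomial ℂ, p ≠ 0 → ∃ z, p.eval z ≠ 0 := fun p hp => by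
    by_contra! h
    exact hp (Polynomial.funext fun z => by simpa using h z)
  obtain ⟨x, hx⟩ := hinf q hq
  have hσx := ne_zero_of_bracket_ne_zero_right (hb x hx)
  -- `r.eval y` is the bracket of `σ x` and `τ y`; with `y ≠ x`, its nonvanishing puts `veronese (τ
  -- y)` off the first chord.
  let r : Polynomial ℂ := Polynomial.C (σ x 0) * Polynomial.X - Polynomial.C (σ x 1)
  have hr : r ≠ 0 := by
    intro h
    apply hσx
    have h0 := congrArg (fun p => Polynomial.coeff p 0) h
    have h1 := congrArg (fun p => Polynomial.coeff p 1) h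
    simp only [r, Polynomial.coeff_sub, Polynomial.coeff_C_mul, Polynomial.coeff_X,
      Polynomial.coeff_C, Polynomial.coeff_zero] at h0 h1
    funext k
    fin_cases k
    · simpa using h1
    · simpa using h0
  obtain ⟨y, hy⟩ := hinf (q * (r * (Polynomial.X - Polynomial.C x)))
    (mul_ne_zero hq (mul_ne_zero hr (Polynomial.X_sub_C_ne_zero x)))
  simp only [Polynomial.eval_mul, mul_ne_zero_iff] at hy
  refine ⟨τ x, σ x, τ y, σ y, hb x hx, hb y hy.1, hσ x, hσ y, ?_⟩
  rw [chordForm_veronese]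
  refine mul_ne_zero ?_ ?_
  · simpa [bracket, τ] using hy.2.2
  · simpa [bracket, τ, r] using hy.2.1

/-! ### Forms of bidegree `(1, 1)` and the Veronese pullback -/

/-- The form of bidegree `(1, 1)` with a given matrix of coefficients. -/
def bilinearForm (a b : ℕ) :
    Matrix (Fin (a + 1)) (Fin (b + 1)) ℂ →ₗ[ℂ] MvPolynomial (Fin (a + 1) ⊕ Fin (b + 1)) ℂ where
  toFun c := ∑ j, ∑ k, c j k • (MvPolynomial.X (Sum.inl j) * MvPolynomial.X (Sum.inr k))
  map_add' c d := by simp [add_smul, Finset.sum_add_distrib]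
  map_smul' r c := by simp [mul_smul, Finset.smul_sum]

theorem bilinearForm_apply {a b : ℕ} (c : Matrix (Fin (a + 1)) (Fin (b + 1)) ℂ) :
    bilinearForm a b c =
      ∑ j, ∑ k, c j k • (MvPolynomial.X (Sum.inl j) * MvPolynomial.X (Sum.inr k)) := rfl

theorem eval_bilinearForm {a b : ℕ} (c : Matrix (Fin (a + 1)) (Fin (b + 1)) ℂ)
    (s : Fin (a + 1) → ℂ) (t : Fin (b + 1) → ℂ) :
    MvPolynomial.eval (Sum.elim s t) (bilinearForm a b c) = ∑ j, ∑ k, c j k * (s j * t k) := by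
  simp [bilinearForm_apply, MvPolynomial.smul_eval]

theorem bilinearForm_single {a b : ℕ} (j : Fin (a + 1)) (k : Fin (b + 1)) (r : ℂ) :
    bilinearForm a b (Matrix.single j k r) =
      MvPolynomial.monomial (Finsupp.single (Sum.inl j) 1 + Finsupp.single (Sum.inr k) 1) r := by
  rw [bilinearForm_apply, Finset.sum_eq_single j, Finset.sum_eq_single k]
  · rw [Matrix.single_apply_same, MvPolynomial.X, MvPolynomial.X, MvPolynomial.monomial_mul,
      MvPolynomial.smul_monomial]
    simp
  · intro k' _ hk
    simp [Matrix.single, hk.symm]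
  · simp
  · intro j' _ hj
    simp [Matrix.single, hj.symm]
  · simp

theorem exists_eq_single_of_sum_eq_one {n : ℕ} {m : Fin n → ℕ} (h : ∑ i, m i = 1) :
    ∃ j, m = Pi.single j 1 := by
  obtain ⟨j, hj⟩ : ∃ j, m j ≠ 0 := by
    by_contra! h0
    simp [h0] at h
  refine ⟨j, ?_⟩
  rw [← Finset.add_sum_erase _ _ (Finset.mem_univ j)] at h
  have hz : ∑ i ∈ Finset.univ.erase j, m i = 0 := by omega
  funext i
  by_cases hi : i = j
  · subst hi
    rw [Pi.single_eq_same]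
    omega
  · rw [Pi.single_eq_of_ne hi]
    exact Finset.sum_eq_zero_iff.mp hz i (by simp [hi])

theorem range_bilinearForm (a b : ℕ) : LinearMap.range (bilinearForm a b) = BiForm a b 1 1 := by
  apply le_antisymm
  · rintro _ ⟨c, rfl⟩
    rw [bilinearForm_apply]
    refine Submodule.sum_mem _ fun j _ => Submodule.sum_mem _ fun k _ =>
      Submodule.smul_mem _ _ ?_
    rw [MvPolynomial.mem_weightedHomogeneousSubmodule]
    simpa [biWeight] using (MvPolynomial.isWeightedHomogeneous_X ℂ (biWeight a b) (Sum.inl j)).mul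
      (MvPolynomial.isWeightedHomogeneous_X ℂ (biWeight a b) (Sum.inr k))
  · intro p hp
    rw [p.as_sum]
    refine Submodule.sum_mem _ fun m hm => ?_
    have hw := hp (MvPolynomial.mem_support_iff.mp hm)
    rw [Finsupp.weight_apply, Finsupp.sum_fintype _ _ (by simp)] at hw
    have hd : ∑ i, m (Sum.inl i) = 1 := by
      simpa [biWeight, Prod.fst_sum, -nsmul_eq_mul] using congrArg Prod.fst hw
    have he : ∑ j, m (Sum.inr j) = 1 := by
      simpa [biWeight, Prod.snd_sum, -nsmul_eq_mul] using congrArg Prod.snd hw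
    obtain ⟨j, hj⟩ := exists_eq_single_of_sum_eq_one hd
    obtain ⟨k, hk⟩ := exists_eq_single_of_sum_eq_one he
    have hmjk : m = Finsupp.single (Sum.inl j) 1 + Finsupp.single (Sum.inr k) 1 := by
      ext (i | i)
      · simpa [Finsupp.single_apply, Pi.single_apply, eq_comm] using congrFun hj i
      · simpa [Finsupp.single_apply, Pi.single_apply, eq_comm] using congrFun hk i
    refine ⟨Matrix.single j k (p.coeff m), ?_⟩
    rw [bilinearForm_single, ← hmjk]

theorem eval_veronesePullback (p : MvPolynomial (Fin 2 ⊕ Fin 3) ℂ) (s t : Fin 2 → ℂ) :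
    MvPolynomial.eval (Sum.elim s t) (veronesePullback p) =
      MvPolynomial.eval (Sum.elim s (veronese t)) p := by
  have h : ((MvPolynomial.aeval (Sum.elim s t) : _ →ₐ[ℂ] ℂ).comp veronesePullback) =
      MvPolynomial.aeval (Sum.elim s (veronese t)) := by
    ext (i | i)
    · simp [veronesePullback]
    · fin_cases i <;> simp [veronesePullback, veronese]
  simpa [MvPolynomial.aeval_eq_eval] using DFunLike.congr_fun h p

theorem veronesePullback_mem {p : MvPolynomial (Fin 2 ⊕ Fin 3) ℂ} (hp : p ∈ BiForm 1 2 1 1) :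
    veronesePullback p ∈ BiForm 1 1 1 2 := by
  rw [← range_bilinearForm] at hp
  obtain ⟨c, rfl⟩ := hp
  rw [bilinearForm_apply]
  simp only [map_sum, map_smul, map_mul]
  refine Submodule.sum_mem _ fun j _ => Submodule.sum_mem _ fun k _ => Submodule.smul_mem _ _ ?_
  rw [MvPolynomial.mem_weightedHomogeneousSubmodule]
  have hs := MvPolynomial.isWeightedHomogeneous_X ℂ (biWeight 1 1) (Sum.inl j)
  have h0 := MvPolynomial.isWeightedHomogeneous_X ℂ (biWeight 1 1) (Sum.inr 0)
  have h1 := MvPolynomial.isWeightedHomogeneous_X ℂ (biWeight 1 1) (Sum.inr 1)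
  fin_cases k
  · simpa [biWeight, veronesePullback] using hs.mul (h0.pow 2)
  · simpa [biWeight, veronesePullback] using hs.mul (h0.mul h1)
  · simpa [biWeight, veronesePullback] using hs.mul (h1.pow 2)

/-- The conic spans the plane: its points at `[1 : 0]`, `[0 : 1]`, `[1 : 1]` are independent, so a
linear form vanishing at all three is zero. -/
theorem eq_zero_of_veronesePullback_bilinearForm {c : Matrix (Fin 2) (Fin 3) ℂ}
    (h : veronesePullback (bilinearForm 1 2 c) = 0) : c = 0 := by
  have key : ∀ s t : Fin 2 → ℂ, ∑ j, ∑ k, c j k * (s j * veronese t k) = 0 := fun s t => by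
    rw [← eval_bilinearForm, ← eval_veronesePullback, h, map_zero]
  ext j k
  have h0 := key (Pi.single j 1) ![1, 0]
  have h1 := key (Pi.single j 1) ![0, 1]
  have h2 := key (Pi.single j 1) ![1, 1]
  fin_cases j <;> simp [Fin.sum_univ_succ, veronese] at h0 h1 h2 <;> fin_cases k <;>
    simp_all

/-- The coefficient matrix of a form of bidegree `(1, 1)` on `ℙ¹ × ℙ²`. -/
def bilinearFormEquiv : Matrix (Fin 2) (Fin 3) ℂ ≃ₗ[ℂ] BiForm 1 2 1 1 :=
  (LinearEquiv.ofInjective (bilinearForm 1 2) ((injective_iff_map_eq_zero _).mpr fun c hc =>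
    eq_zero_of_veronesePullback_bilinearForm (by rw [hc, map_zero]))) ≪≫ₗ
    LinearEquiv.ofEq _ _ (range_bilinearForm 1 2)

theorem coe_bilinearFormEquiv (c : Matrix (Fin 2) (Fin 3) ℂ) :
    (bilinearFormEquiv c : MvPolynomial (Fin 2 ⊕ Fin 3) ℂ) = bilinearForm 1 2 c := rfl

/-- The Veronese pullback from forms of bidegree `(1, 1)` to forms of bidegree `(1, 2)`. -/
def biFormPullback : BiForm 1 2 1 1 →ₗ[ℂ] BiForm 1 1 1 2 :=
  veronesePullback.toLinearMap.restrict fun _ => veronesePullback_mem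

theorem biFormPullback_injective : Function.Injective biFormPullback := by
  rw [injective_iff_map_eq_zero]
  intro p hp
  obtain ⟨c, rfl⟩ := bilinearFormEquiv.surjective p
  rw [eq_zero_of_veronesePullback_bilinearForm (c := c) (congrArg Subtype.val hp), map_zero]

/-- The pullback is injective between spaces of equal dimension, the target's dimension being read
off from `f`; so `F` must be the preimage of `f`. -/
theorem existsUnique_isVeroneseExtension (f : Module.Basis (Fin 6) ℂ (BiForm 1 1 1 2)) :
    ∃! F : Module.Basis (Fin 6) ℂ (BiForm 1 2 1 1), IsVeroneseExtension f F := by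
  have : FiniteDimensional ℂ (BiForm 1 1 1 2) := f.finiteDimensional_of_finite
  have : FiniteDimensional ℂ (BiForm 1 2 1 1) := bilinearFormEquiv.finiteDimensional
  let e : BiForm 1 2 1 1 ≃ₗ[ℂ] BiForm 1 1 1 2 :=
    LinearMap.linearEquivOfInjective biFormPullback biFormPullback_injective (by
      rw [← bilinearFormEquiv.finrank_eq, Module.finrank_eq_card_basis f]
      simp [Module.finrank_matrix])
  refine ⟨f.map e.symm, fun i => ?_, fun F hF => ?_⟩
  · rw [Module.Basis.map_apply]
    exact congrArg Subtype.val (e.apply_symm_apply (f i))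
  · refine Module.Basis.eq_of_apply_eq fun i => e.injective ?_
    rw [Module.Basis.map_apply, LinearEquiv.apply_symm_apply]
    exact Subtype.ext (hF i)

/-! ### Linear coordinates on `ℙ⁵` -/

/-- The linear map sending a `2 × 3` matrix `M` to the pairings of `M` with the coefficient matrices
of the forms `F i`; it is evaluation of the forms on matrices of rank one. -/
def segreLinearMap (F : Fin 6 → BiForm 1 2 1 1) :
    Matrix (Fin 2) (Fin 3) ℂ →ₗ[ℂ] (Fin 6 → ℂ) where
  toFun M i := ∑ j, ∑ k, bilinearFormEquiv.symm (F i) j k * M j k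
  map_add' M N := by
    funext i
    simp [mul_add, Finset.sum_add_distrib]
  map_smul' r M := by
    funext i
    simp [Finset.mul_sum, mul_left_comm, -Fin.sum_univ_two]

theorem segreLinearMap_vecMulVec (F : Fin 6 → BiForm 1 2 1 1) (s : Fin 2 → ℂ) (w : Fin 3 → ℂ) :
    segreLinearMap F (vecMulVec s w) = evalVec F s w := by
  funext i
  conv_rhs => rw [evalVec, ← bilinearFormEquiv.apply_symm_apply (F i), coe_bilinearFormEquiv,
    eval_bilinearForm]
  rfl

/-- Pairing with `M` is a functional on forms. If it vanishes on the basis it vanishes on every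
form, and forms with a single nonzero coefficient recover the entries of `M`. -/
theorem segreLinearMap_injective (F : Module.Basis (Fin 6) ℂ (BiForm 1 2 1 1)) :
    Function.Injective (segreLinearMap F) := by
  rw [injective_iff_map_eq_zero]
  intro M hM
  let L : BiForm 1 2 1 1 →ₗ[ℂ] ℂ :=
    { toFun := fun p => ∑ j, ∑ k, bilinearFormEquiv.symm p j k * M j k
      map_add' := fun p q => by simp [add_mul, Finset.sum_add_distrib]
      map_smul' := fun r p => by simp [Finset.mul_sum, mul_assoc, -Fin.sum_univ_two] }
  have hL : L = 0 := F.ext fun i => congrFun hM i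
  ext j k
  have h := LinearMap.congr_fun hL (bilinearFormEquiv (Matrix.single j k 1))
  simpa [L, Matrix.single, ite_and, -Fin.sum_univ_two] using h

/-- The linear change of coordinates on `ℂ⁶` that turns the Segre embedding into the space of
`2 × 3` matrices of rank one. -/
def segreEquiv (F : Module.Basis (Fin 6) ℂ (BiForm 1 2 1 1)) :
    Matrix (Fin 2) (Fin 3) ℂ ≃ₗ[ℂ] (Fin 6 → ℂ) :=
  LinearMap.linearEquivOfInjective (segreLinearMap F) (segreLinearMap_injective F)
    (by simp [Module.finrank_matrix])

theorem segreEquiv_vecMulVec (F : Module.Basis (Fin 6) ℂ (BiForm 1 2 1 1)) (s : Fin 2 → ℂ)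
    (w : Fin 3 → ℂ) : segreEquiv F (vecMulVec s w) = evalVec F s w :=
  segreLinearMap_vecMulVec F s w

theorem evalVec_veronese {f : Module.Basis (Fin 6) ℂ (BiForm 1 1 1 2)}
    {F : Module.Basis (Fin 6) ℂ (BiForm 1 2 1 1)} (h : IsVeroneseExtension f F)
    (s t : Fin 2 → ℂ) :
    evalVec f s t = segreEquiv F (vecMulVec s (veronese t)) := by
  rw [segreEquiv_vecMulVec]
  funext i
  rw [evalVec, evalVec, ← h i, eval_veronesePullback]

/-! ### Secants -/

theorem span_pair_mk {K V : Type*} [DivisionRing K] [AddCommGroup V] [Module K V] {x y : V}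
    (hx : x ≠ 0) (hy : y ≠ 0) :
    Projectivization.Subspace.span {Projectivization.mk K x hx, Projectivization.mk K y hy} =
      (Submodule.span K {x, y}).projectivization := by
  apply le_antisymm
  · rw [Projectivization.Subspace.span_le_subspace_iff]
    rintro _ (rfl | rfl)
    · exact Submodule.subset_span (Set.mem_insert _ _)
    · exact Submodule.subset_span (Set.mem_insert_of_mem _ rfl)
  · rw [← Projectivization.Subspace.submodule.le_iff_le, OrderIso.apply_symm_apply,
      Submodule.span_le]
    rintro _ (rfl | rfl)
    · exact (Projectivization.Subspace.mem_submodule_iff _ hx).mpr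
        (Projectivization.Subspace.subset_span _ (Set.mem_insert _ _))
    · exact (Projectivization.Subspace.mem_submodule_iff _ hy).mpr
        (Projectivization.Subspace.subset_span _ (Set.mem_insert_of_mem _ rfl))

theorem span_smul_pair {K V : Type*} [Field K] [AddCommGroup V] [Module K V] (x y : V)
    {a b : K} (ha : a ≠ 0) (hb : b ≠ 0) :
    Submodule.span K {a • x, b • y} = Submodule.span K {x, y} := by
  rw [Submodule.span_insert, Submodule.span_insert, Submodule.span_singleton_smul_eq ha.isUnit,
    Submodule.span_singleton_smul_eq hb.isUnit]

/-- The line in `ℙ⁵` spanned by two matrices. -/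
def matrixLine (F : Module.Basis (Fin 6) ℂ (BiForm 1 2 1 1)) (A B : Matrix (Fin 2) (Fin 3) ℂ) :
    Projectivization.Subspace ℂ (Fin 6 → ℂ) :=
  (Submodule.span ℂ {segreEquiv F A, segreEquiv F B}).projectivization

theorem matrixLine_comm (F : Module.Basis (Fin 6) ℂ (BiForm 1 2 1 1))
    (A B : Matrix (Fin 2) (Fin 3) ℂ) : matrixLine F A B = matrixLine F B A := by
  rw [matrixLine, matrixLine, Set.pair_comm]

theorem mk_mem_matrixLine {F : Module.Basis (Fin 6) ℂ (BiForm 1 2 1 1)}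
    {A B M : Matrix (Fin 2) (Fin 3) ℂ} (hM : segreEquiv F M ≠ 0) :
    Projectivization.mk ℂ (segreEquiv F M) hM ∈ matrixLine F A B ↔
      ∃ a b : ℂ, a • A + b • B = M := by
  rw [matrixLine, Submodule.mk_mem_projectivization_iff, Submodule.mem_span_pair]
  simp only [← map_smul, ← map_add, EmbeddingLike.apply_eq_iff_eq]

section Secants

variable {f : Module.Basis (Fin 6) ℂ (BiForm 1 1 1 2)}
  {F : Module.Basis (Fin 6) ℂ (BiForm 1 2 1 1)}

/-- Only `t` and `t'` must be independent; `s = s'` is allowed and gives the secants through points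
of the threefold. -/
theorem isSecant_matrixLine (hF : IsVeroneseExtension f F) {s s' t t' : Fin 2 → ℂ}
    (hs : s ≠ 0) (hs' : s' ≠ 0) (ht : bracket t t' ≠ 0) :
    IsSecant (n := 5) (linearSeriesImage f)
      (matrixLine F (vecMulVec s (veronese t)) (vecMulVec s' (veronese t'))) := by
  have h0 := ne_zero_of_bracket_ne_zero ht
  have h0' := ne_zero_of_bracket_ne_zero_right ht
  refine ⟨_, ⟨(.mk ℂ s hs, .mk ℂ t h0), rfl⟩, _, ⟨(.mk ℂ s' hs', .mk ℂ t' h0'), rfl⟩, ?_, ?_⟩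
  · rw [linearSeriesMap_mk, linearSeriesMap_mk, Ne, Projectivization.mk_eq_mk_iff']
    rintro ⟨c, hc⟩
    rw [evalVec_veronese hF, evalVec_veronese hF, ← map_smul, EmbeddingLike.apply_eq_iff_eq] at hc
    -- Proportional endpoints would give `s ⊗ ν(t) + 0 = 0 + c s' ⊗ ν(t')`, and comparing
    -- coefficients forces `s = 0`.
    refine hs (decomposition_coeff_unique ht (s₂ := 0) (s₃ := 0) (s₄ := c • s') ?_).1
    rw [smul_vecMulVec, hc]
    simp
  · rw [linearSeriesMap_mk, linearSeriesMap_mk, span_pair_mk, evalVec_veronese hF,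
      evalVec_veronese hF, matrixLine]

/-- Off the threefold both coefficients of `M` along the secant are nonzero, so they can be absorbed
into `s` and `s'` without changing the line. -/
theorem exists_decomposition_of_isSecant (hF : IsVeroneseExtension f F)
    {l : Projectivization.Subspace ℂ (Fin 6 → ℂ)}
    (hl : IsSecant (n := 5) (linearSeriesImage f) l) {M : Matrix (Fin 2) (Fin 3) ℂ}
    (hM : ∀ s w, M ≠ vecMulVec s w) (h0 : segreEquiv F M ≠ 0)
    (hp : Projectivization.mk ℂ (segreEquiv F M) h0 ∈ l) :
    ∃ s s' t t' : Fin 2 → ℂ, M = vecMulVec s (veronese t) + vecMulVec s' (veronese t') ∧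
      l = matrixLine F (vecMulVec s (veronese t)) (vecMulVec s' (veronese t')) := by
  obtain ⟨_, ⟨⟨x, y⟩, rfl⟩, _, ⟨⟨x', y'⟩, rfl⟩, -, rfl⟩ := hl
  induction x using Projectivization.ind with | h s hs
  induction y using Projectivization.ind with | h t ht
  induction x' using Projectivization.ind with | h s' hs'
  induction y' using Projectivization.ind with | h t' ht'
  have hline : Projectivization.Subspace.span
      {linearSeriesMap f (.mk ℂ s hs, .mk ℂ t ht), linearSeriesMap f (.mk ℂ s' hs', .mk ℂ t' ht')} =
      matrixLine F (vecMulVec s (veronese t)) (vecMulVec s' (veronese t')) := by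
    rw [linearSeriesMap_mk, linearSeriesMap_mk, span_pair_mk, evalVec_veronese hF,
      evalVec_veronese hF, matrixLine]
  rw [hline, mk_mem_matrixLine] at hp
  obtain ⟨a, b, rfl⟩ := hp
  have ha : a ≠ 0 := by
    rintro rfl
    exact hM (b • s') (veronese t') (by rw [smul_vecMulVec, zero_smul, zero_add])
  have hb : b ≠ 0 := by
    rintro rfl
    exact hM (a • s) (veronese t) (by rw [smul_vecMulVec, zero_smul, add_zero])
  refine ⟨a • s, b • s', t, t', by rw [smul_vecMulVec, smul_vecMulVec], ?_⟩
  rw [hline, matrixLine, matrixLine, smul_vecMulVec, smul_vecMulVec, map_smul, map_smul,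
    span_smul_pair _ _ ha hb]

/-- A point off the Segre threefold lies on at most one secant to the scroll. -/
theorem secant_unique (hF : IsVeroneseExtension f F)
    {l₁ l₂ : Projectivization.Subspace ℂ (Fin 6 → ℂ)}
    (hl₁ : IsSecant (n := 5) (linearSeriesImage f) l₁)
    (hl₂ : IsSecant (n := 5) (linearSeriesImage f) l₂) {M : Matrix (Fin 2) (Fin 3) ℂ}
    (hM : ∀ s w, M ≠ vecMulVec s w) (h0 : segreEquiv F M ≠ 0)
    (hp₁ : Projectivization.mk ℂ (segreEquiv F M) h0 ∈ l₁)
    (hp₂ : Projectivization.mk ℂ (segreEquiv F M) h0 ∈ l₂) : l₁ = l₂ := by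
  obtain ⟨_, _, _, _, h₁, rfl⟩ := exists_decomposition_of_isSecant hF hl₁ hM h0 hp₁
  obtain ⟨_, _, _, _, h₂, rfl⟩ := exists_decomposition_of_isSecant hF hl₂ hM h0 hp₂
  rcases decomposition_unique hM h₁ h₂ with ⟨h, h'⟩ | ⟨h, h'⟩
  · rw [h, h']
  · rw [h, h', matrixLine_comm]

/-- A point with nonzero discriminant lies on exactly one secant to the scroll. -/
theorem existsUnique_secant (hF : IsVeroneseExtension f F) {M : Matrix (Fin 2) (Fin 3) ℂ}
    (hd : secantDiscriminant M ≠ 0) (h0 : segreEquiv F M ≠ 0) :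
    ∃! l : Projectivization.Subspace ℂ (Fin 6 → ℂ),
      IsSecant (n := 5) (linearSeriesImage f) l ∧
        Projectivization.mk ℂ (segreEquiv F M) h0 ∈ l := by
  have hM : ∀ s w, M ≠ vecMulVec s w := by
    rintro s w rfl
    exact hd (secantDiscriminant_vecMulVec s w)
  obtain ⟨s, s', t, t', h⟩ := exists_decomposition hd
  obtain ⟨hs, ht⟩ := bracket_ne_zero_of_eq_add hM h
  have hl := isSecant_matrixLine hF (ne_zero_of_bracket_ne_zero hs)
    (ne_zero_of_bracket_ne_zero_right hs) ht
  have hp : Projectivization.mk ℂ (segreEquiv F M) h0 ∈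
      matrixLine F (vecMulVec s (veronese t)) (vecMulVec s' (veronese t')) :=
    (mk_mem_matrixLine h0).mpr ⟨1, 1, by rw [one_smul, one_smul, h]⟩
  exact ⟨_, ⟨hl, hp⟩, fun l' hl' => secant_unique hF hl'.1 hl hM h0 hl'.2 hp⟩

theorem exists_two_secants (hF : IsVeroneseExtension f F) {s : Fin 2 → ℂ} {w : Fin 3 → ℂ}
    (hs : s ≠ 0) (hw : w ≠ 0) (h0 : segreEquiv F (vecMulVec s w) ≠ 0) :
    ∃ l₁ l₂ : Projectivization.Subspace ℂ (Fin 6 → ℂ), l₁ ≠ l₂ ∧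
      (IsSecant (n := 5) (linearSeriesImage f) l₁ ∧
        Projectivization.mk ℂ (segreEquiv F (vecMulVec s w)) h0 ∈ l₁) ∧
      (IsSecant (n := 5) (linearSeriesImage f) l₂ ∧
        Projectivization.mk ℂ (segreEquiv F (vecMulVec s w)) h0 ∈ l₂) := by
  obtain ⟨t₁, t₂, t₃, t₄, h12, h34, hw12, hw34, hne⟩ := exists_two_chords hw
  have hmem : ∀ {t t' : Fin 2 → ℂ}, bracket t t' ≠ 0 → chordForm t t' w = 0 →
      Projectivization.mk ℂ (segreEquiv F (vecMulVec s w)) h0 ∈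
        matrixLine F (vecMulVec s (veronese t)) (vecMulVec s (veronese t')) := by
    intro t t' ht htw
    obtain ⟨a, b, hab⟩ := exists_eq_add_of_chordForm_eq_zero ht htw
    exact (mk_mem_matrixLine h0).mpr
      ⟨a, b, by rw [hab, vecMulVec_add, vecMulVec_smul, vecMulVec_smul]⟩
  refine ⟨_, _, fun heq => ?_, ⟨isSecant_matrixLine hF hs hs h12, hmem h12 hw12⟩,
    ⟨isSecant_matrixLine hF hs hs h34, hmem h34 hw34⟩⟩
  -- The point `s ⊗ ν(t₃)` separates the lines: on the first line, a row with `s j ≠ 0` would put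
  -- `ν(t₃)` on the chord through `ν(t₁)` and `ν(t₂)`.
  have h3 : segreEquiv F (vecMulVec s (veronese t₃)) ≠ 0 := by
    rw [← evalVec_veronese hF]
    exact evalVec_ne_zero f hs (ne_zero_of_bracket_ne_zero h34)
  have hm : Projectivization.mk ℂ _ h3 ∈
      matrixLine F (vecMulVec s (veronese t₃)) (vecMulVec s (veronese t₄)) :=
    (mk_mem_matrixLine h3).mpr ⟨1, 0, by simp⟩
  rw [← heq, mk_mem_matrixLine] at hm
  obtain ⟨a, b, hab⟩ := hm
  obtain ⟨j, hj⟩ := Function.ne_iff.mp hs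
  have hrow : s j • veronese t₃ = (s j * a) • veronese t₁ + (s j * b) • veronese t₂ := by
    have := congrFun hab j
    rw [mul_comm, mul_smul, mul_comm, mul_smul]
    exact this.symm
  have hc := congrArg (chordForm t₁ t₂) hrow
  rw [chordForm_add, chordForm_smul, chordForm_smul, chordForm_smul, chordForm_veronese t₁ t₂ t₁,
    chordForm_veronese t₁ t₂ t₂, bracket_self, bracket_self] at hc
  simp only [zero_mul, mul_zero, add_zero] at hc
  exact mul_ne_zero hj hne hc

/-- The points on more than one secant to the scroll are those of the Segre threefold. -/
theorem setOf_two_secants_eq (hF : IsVeroneseExtension f F) :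
    {p : PSpace 5 | ∃ l₁ l₂ : Projectivization.Subspace ℂ (Fin 6 → ℂ), l₁ ≠ l₂ ∧
      (IsSecant (n := 5) (linearSeriesImage f) l₁ ∧ p ∈ l₁) ∧
      (IsSecant (n := 5) (linearSeriesImage f) l₂ ∧ p ∈ l₂)} = linearSeriesImage F := by
  ext p
  constructor
  · rintro ⟨l₁, l₂, hne, ⟨hl₁, hp₁⟩, hl₂, hp₂⟩
    induction p using Projectivization.ind with | h v hv
    obtain ⟨M, rfl⟩ := (segreEquiv F).surjective v
    by_contra hp
    refine hne (secant_unique hF hl₁ hl₂ ?_ hv hp₁ hp₂)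
    rintro s w rfl
    have hs : s ≠ 0 := by
      rintro rfl
      exact hv (by rw [zero_vecMulVec, map_zero])
    have hw : w ≠ 0 := by
      rintro rfl
      have hz : vecMulVec s (0 : Fin 3 → ℂ) = 0 := by
        ext
        simp [vecMulVec_apply]
      exact hv (by rw [hz, map_zero])
    refine hp ⟨(.mk ℂ s hs, .mk ℂ w hw), ?_⟩
    rw [linearSeriesMap_mk]
    congr 1
    exact (segreEquiv_vecMulVec F s w).symm
  · rintro ⟨⟨x, y⟩, rfl⟩
    induction x using Projectivization.ind with | h s hs
    induction y using Projectivization.ind with | h w hw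
    have h0 : segreEquiv F (vecMulVec s w) ≠ 0 := by
      rw [segreEquiv_vecMulVec]
      exact evalVec_ne_zero F hs hw
    have he : linearSeriesMap F (.mk ℂ s hs, .mk ℂ w hw) =
        Projectivization.mk ℂ (segreEquiv F (vecMulVec s w)) h0 := by
      rw [linearSeriesMap_mk]
      congr 1
      exact (segreEquiv_vecMulVec F s w).symm
    rw [he]
    exact exists_two_secants hF hs hw h0

end Secants

/-! ### The generic point -/

/-- The matrix of linear forms on `ℂ⁶` inverting `segreEquiv F`. -/
def coordinateMatrix (F : Module.Basis (Fin 6) ℂ (BiForm 1 2 1 1)) :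
    Matrix (Fin 2) (Fin 3) (MvPolynomial (Fin 6) ℂ) :=
  Matrix.of fun j k =>
    ∑ i, MvPolynomial.C ((segreEquiv F).symm (Pi.single i 1) j k) * MvPolynomial.X i

theorem eval_coordinateMatrix (F : Module.Basis (Fin 6) ℂ (BiForm 1 2 1 1)) (v : Fin 6 → ℂ)
    (j : Fin 2) (k : Fin 3) :
    MvPolynomial.eval v (coordinateMatrix F j k) = (segreEquiv F).symm v j k := by
  conv_rhs => rw [pi_eq_sum_univ' v, map_sum]
  simp only [coordinateMatrix, Matrix.of_apply, map_sum, map_mul, MvPolynomial.eval_C,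
    MvPolynomial.eval_X, map_smul, Matrix.sum_apply, Matrix.smul_apply, smul_eq_mul]
  refine Finset.sum_congr rfl fun i _ => ?_
  rw [mul_comm]

theorem eval_secantDiscriminant (F : Module.Basis (Fin 6) ℂ (BiForm 1 2 1 1)) (v : Fin 6 → ℂ) :
    MvPolynomial.eval v (secantDiscriminant (coordinateMatrix F)) =
      secantDiscriminant ((segreEquiv F).symm v) := by
  simp only [secantDiscriminant, map_sub, map_mul, map_pow, map_ofNat, eval_coordinateMatrix]

theorem isHomogeneous_secantDiscriminant (F : Module.Basis (Fin 6) ℂ (BiForm 1 2 1 1)) :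
    (secantDiscriminant (coordinateMatrix F)).IsHomogeneous 4 := by
  have h : ∀ j k, (coordinateMatrix F j k).IsHomogeneous 1 := fun j k => by
    rw [coordinateMatrix, Matrix.of_apply]
    exact MvPolynomial.IsHomogeneous.sum _ _ _ fun i _ =>
      MvPolynomial.IsHomogeneous.C_mul (MvPolynomial.isHomogeneous_X ℂ i) _
  have hm : ∀ j k j' k' i l i' l', (coordinateMatrix F j k * coordinateMatrix F j' k' -
      coordinateMatrix F i l * coordinateMatrix F i' l').IsHomogeneous 2 :=
    fun j k j' k' i l i' l' => ((h j k).mul (h j' k')).sub ((h i l).mul (h i' l'))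
  rw [secantDiscriminant, mul_assoc]
  refine ((hm _ _ _ _ _ _ _ _).pow 2).sub ?_
  exact MvPolynomial.IsHomogeneous.C_mul ((hm _ _ _ _ _ _ _ _).mul (hm _ _ _ _ _ _ _ _)) 4

theorem holdsGenerically_existsUnique_secant {f : Module.Basis (Fin 6) ℂ (BiForm 1 1 1 2)}
    {F : Module.Basis (Fin 6) ℂ (BiForm 1 2 1 1)} (hF : IsVeroneseExtension f F) :
    HoldsGenerically (fun p : PSpace 5 => ∃! l : Projectivization.Subspace ℂ (Fin 6 → ℂ),
      IsSecant (n := 5) (linearSeriesImage f) l ∧ p ∈ l) := by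
  let g := secantDiscriminant (coordinateMatrix F)
  refine ⟨{p | MvPolynomial.eval p.rep g ≠ 0}, ⟨{g}, ?_, ?_⟩, ?_, fun p hp => ?_⟩
  · rintro _ rfl
    exact ⟨4, isHomogeneous_secantDiscriminant F⟩
  · ext p
    simp
  -- The rows are `ν(1, 0)` and `ν(0, 1)`, so the row space is a genuine chord; the discriminant is
  -- `1`, and `c ^ 4` after rescaling to the chosen representative.
  · let M : Matrix (Fin 2) (Fin 3) ℂ := !![1, 0, 0; 0, 0, 1]
    have hM : segreEquiv F M ≠ 0 := by
      rw [Ne, LinearEquiv.map_eq_zero_iff]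
      intro h
      simpa [M] using congrFun (congrFun h 0) 0
    refine ⟨Projectivization.mk ℂ (segreEquiv F M) hM, ?_⟩
    obtain ⟨c, hc⟩ := Projectivization.exists_smul_eq_mk_rep ℂ _ hM
    have hc0 : (c : ℂ) ≠ 0 := c.ne_zero
    rw [Set.mem_ofPred_eq, ← hc, eval_secantDiscriminant, Units.smul_def, map_smul,
      LinearEquiv.symm_apply_apply]
    simp [secantDiscriminant, M, hc0]
  · rw [Set.mem_ofPred_eq, eval_secantDiscriminant] at hp
    have h0 : segreEquiv F ((segreEquiv F).symm p.rep) ≠ 0 := by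
      rw [LinearEquiv.apply_symm_apply]
      exact p.rep_nonzero
    have hpe : Projectivization.mk ℂ _ h0 = p := by
      simp only [LinearEquiv.apply_symm_apply, Projectivization.mk_rep]
    have := existsUnique_secant hF hp h0
    rwa [hpe] at this

end QuarticScroll

end

theorem mainTheorem9
    (f : Module.Basis (Fin 6) ℂ (QuarticScroll.BiForm 1 1 1 2)) :
    QuarticScroll.HoldsGenerically (fun p : QuarticScroll.PSpace 5 =>
      ∃! l : Projectivization.Subspace ℂ (Fin 6 → ℂ),
        QuarticScroll.IsSecant (n := 5) (QuarticScroll.linearSeriesImage f) l ∧ p ∈ l) ∧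
    (∃! F : Module.Basis (Fin 6) ℂ (QuarticScroll.BiForm 1 2 1 1),
      QuarticScroll.IsVeroneseExtension f F) ∧
    ∀ F : Module.Basis (Fin 6) ℂ (QuarticScroll.BiForm 1 2 1 1),
      QuarticScroll.IsVeroneseExtension f F →
      {p : QuarticScroll.PSpace 5 |
        ∃ l₁ l₂ : Projectivization.Subspace ℂ (Fin 6 → ℂ), l₁ ≠ l₂ ∧
          (QuarticScroll.IsSecant (n := 5) (QuarticScroll.linearSeriesImage f) l₁ ∧ p ∈ l₁) ∧
          (QuarticScroll.IsSecant (n := 5) (QuarticScroll.linearSeriesImage f) l₂ ∧ p ∈ l₂)} =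
        QuarticScroll.linearSeriesImage F := by
  obtain ⟨F, hF, -⟩ := QuarticScroll.existsUnique_isVeroneseExtension f
  exact ⟨QuarticScroll.holdsGenerically_existsUnique_secant hF,
    QuarticScroll.existsUnique_isVeroneseExtension f,
    fun _ hF => QuarticScroll.setOf_two_secants_eq hF⟩
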